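/- Let $g=(g_{ij})_{i,j\in\mathbf Z}$ be a complex lower triangular matrix ($g_{ij}=0$ for $j>i$) that is invertible, with lower triangular inverse $g^{-1}=(g^{-1}_{ij})$. Every such $g$ is of the form $g=e^{A}$ with $A$ lower triangular. For $k\in\mathbf Z$ define the formal series $$w^g_k(z)=\sum_{j\le k-1} g_{-j-1,-k}\,z^j,\qquad w^{g*}_k(z)=\sum_{j\le k-1} g^{-1}_{k-1,j}\,z^j ,$$ and let $$\tilde Q^+_{kj}=\sum_{i=-k-1}^{-j} g^{-1}_{-j,i}\,g_{i+1,-k}\quad (j\le k+1),\qquad \tilde Q^+_{kj}=0\quad (j>k+1).$$ On the fermionic Fock space, spanned (allowing infinite linear combinations) by the semi-infinite wedge products $e_{l_1}\wedge e_{l_2}\wedge\cdots$ with $l_1>l_2>\cdots$ integers such that only finitely many $l_i$ are non-negative and all but finitely many negative integers occur, let $\psi_i=e_i\wedge$ and let $\psi^*_i$ be the interior product with the dual of $e_i$; let $|0\rangle=e_{-1}\wedge e_{-2}\wedge\cdots$, $\psi(z)=\sum_i\psi_iz^i$, $\psi^*(w)=\sum_i\psi^*_iw^{-i-1}$, and $\hat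 g=\exp\big(\sum_{i,j}A_{ij}:\!\psi_i\psi^*_j\!:\big)$, where $:\!\psi_i\psi_j^*\!:\;=\psi_i\psi_j^*-\langle0|\psi_i\psi^*_j|0\rangle$. The pair correlator is $$\tilde K^g_2(z,w)=\begin{cases}\ \ \langle 0|\psi(z)\psi^*(w)\hat g|0\rangle, & |z|>|w|,\\ -\langle 0|\psi^*(w)\psi(z)\hat g|0\rangle, & |z|<|w|,\end{cases}$$ each case being understood as a formal Laurent series in $z,w$. Then, for any lower triangular $A$ with $e^A=g$, $$(z-w)\,\tilde K^g_2(w,z)=\sum_{i=0}^\infty\sum_{j=0}^\infty \tilde Q^+_{j+1,-i}\,w^g_{-i}(z)\,w^{g*}_{-j}(w)-\tilde Q^+_{01}\,w^g_1(z)\,w^{g*}_1(w)$$ as an identity of formal series, for both of the series $\tilde K^g_2(w,z)$; in the double sum only finitely many terms contribute to each monomial. Moreover each of the two series $\tilde K^g_2(w,z)$ equals the right-hand side divided by $z-w$, with $1/(z-w)$ expanded in the corresponding region: as $\sum_{k\ge0}w^kz^{-k-1}$ for $|z|>|w|$ and as $-\sum_{k\ge0}z^kw^{-k-1}$ for $|z|<|w|$.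 -/

import Mathlib

noncomputable section

namespace FermionicCD

/-! ### Lower triangular matrices indexed by the integers -/

/-- The ring of lower triangular `ℤ × ℤ` complex matrices (`g i j = 0` for `j > i`), with the matrix
product: this is the incidence algebra of `ℤ` with the reversed order. -/
abbrev LowerTri : Type := IncidenceAlgebra ℂ ℤᵒᵈ

/-- The entry `g_{ij}`. -/
def entry (g : LowerTri) (i j : ℤ) : ℂ := g (OrderDual.toDual i) (OrderDual.toDual j)

/-- `g = e^A`: every entry of `g` is the sum of the corresponding entries of `A ^ n / n!`. -/
def IsExp (A g : LowerTri) : Prop :=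
  ∀ i j : ℤ, HasSum (fun n : ℕ => entry (A ^ n) i j / (n.factorial : ℂ)) (entry g i j)

theorem entry_of_lt (g : LowerTri) {i j : ℤ} (h : i < j) : entry g i j = 0 := by
  apply IncidenceAlgebra.apply_eq_zero_of_not_le
  intro h'
  exact absurd (OrderDual.toDual_le_toDual.mp h') (not_le.mpr h)

theorem entry_one (i j : ℤ) : entry 1 i j = if i = j then 1 else 0 := by
  simp [entry, IncidenceAlgebra.one_apply]

theorem entry_mul (g h : LowerTri) (i j : ℤ) :
    entry (g * h) i j = ∑ x ∈ Finset.Icc j i, entry g i x * entry h x j := by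
  unfold entry
  rw [IncidenceAlgebra.mul_apply]
  refine Finset.sum_nbij' (fun x => OrderDual.ofDual x) (fun x => OrderDual.toDual x) ?_ ?_ ?_ ?_ ?_
  · intro x hx
    rw [Finset.mem_Icc] at hx ⊢
    exact ⟨hx.2, hx.1⟩
  · intro x hx
    rw [Finset.mem_Icc] at hx ⊢
    exact ⟨hx.2, hx.1⟩
  all_goals intros; rfl

theorem summable_exp (A : LowerTri) (i j : ℤ) :
    Summable (fun n : ℕ => entry (A ^ n) i j / (n.factorial : ℂ)) := by
  set B := Finset.Icc j i
  set C : ℝ := ∑ k ∈ B, ∑ x ∈ B, ‖entry A k x‖ with hC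
  have hC0 : 0 ≤ C := by positivity
  have key : ∀ n : ℕ, ∀ k ∈ B, ‖entry (A ^ n) k j‖ ≤ C ^ n := by
    intro n
    induction n with
    | zero =>
      intro k _
      rw [pow_zero, pow_zero, entry_one]
      split_ifs <;> simp
    | succ n ih =>
      intro k hk
      have hk' := Finset.mem_Icc.mp hk
      have hsub : Finset.Icc j k ⊆ B := Finset.Icc_subset_Icc_right hk'.2
      rw [pow_succ', entry_mul]
      calc ‖∑ x ∈ Finset.Icc j k, entry A k x * entry (A ^ n) x j‖
          ≤ ∑ x ∈ Finset.Icc j k, ‖entry A k x * entry (A ^ n) x j‖ := norm_sum_le _ _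
        _ ≤ ∑ x ∈ Finset.Icc j k, ‖entry A k x‖ * C ^ n := by
            refine Finset.sum_le_sum fun x hx => ?_
            rw [norm_mul]
            exact mul_le_mul_of_nonneg_left (ih x (hsub hx)) (norm_nonneg _)
        _ = (∑ x ∈ Finset.Icc j k, ‖entry A k x‖) * C ^ n := by rw [Finset.sum_mul]
        _ ≤ C * C ^ n := by
            refine mul_le_mul_of_nonneg_right ?_ (pow_nonneg hC0 n)
            calc ∑ x ∈ Finset.Icc j k, ‖entry A k x‖ ≤ ∑ x ∈ B, ‖entry A k x‖ :=
                  Finset.sum_le_sum_of_subset_of_nonneg hsub (fun _ _ _ => norm_nonneg _)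
              _ ≤ C := Finset.single_le_sum (f := fun k => ∑ x ∈ B, ‖entry A k x‖)
                  (fun _ _ => Finset.sum_nonneg fun _ _ => norm_nonneg _) hk
        _ = C ^ (n + 1) := by rw [pow_succ']
  by_cases hij : j ≤ i
  · refine Summable.of_norm_bounded (Real.summable_pow_div_factorial C) fun n => ?_
    rw [norm_div, Complex.norm_natCast]
    gcongr
    exact key n i (Finset.mem_Icc.mpr ⟨hij, le_rfl⟩)
  · have : (fun n : ℕ => entry (A ^ n) i j / (n.factorial : ℂ)) = fun _ => 0 := by
      funext n
      rw [entry_of_lt _ (not_le.mp hij), zero_div]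
    rw [this]
    exact summable_zero

/-- Changing `A` on the `d`-th subdiagonal changes the `d`-th subdiagonal of `A ^ n` linearly. -/
theorem entry_pow_sub (A B : LowerTri) (d : ℕ)
    (h : ∀ k l : ℤ, k - l < d → entry A k l = entry B k l) (n : ℕ) :
    (∀ k l : ℤ, k - l < d → entry (A ^ n) k l = entry (B ^ n) k l) ∧
    (0 < d → ∀ k l : ℤ, k - l = d → entry (A ^ n) k l - entry (B ^ n) k l =
      (∑ m ∈ Finset.range n, entry B k k ^ m * entry B l l ^ (n - 1 - m)) *
        (entry A k l - entry B k l)) := by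
  induction n with
  | zero => simp
  | succ n ih =>
    obtain ⟨ih1, ih2⟩ := ih
    constructor
    · intro k l hkl
      rw [pow_succ, pow_succ, entry_mul, entry_mul]
      refine Finset.sum_congr rfl fun x hx => ?_
      have := Finset.mem_Icc.mp hx
      rw [ih1 k x (by omega), h x l (by omega)]
    · intro hd k l hkl
      have hdiag : ∀ (M : LowerTri) (n : ℕ) (k : ℤ), entry (M ^ n) k k = entry M k k ^ n := by
        intro M n k
        induction n with
        | zero => simp [entry_one]
        | succ n ih => rw [pow_succ, entry_mul]; simp [ih, pow_succ]
      rw [pow_succ, pow_succ, entry_mul, entry_mul, ← Finset.sum_sub_distrib]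
      have hlk : l < k := by omega
      rw [Finset.sum_eq_add (a := l) (b := k) (by omega)]
      · have e1 : entry A l l = entry B l l := h l l (by omega)
        have e2 : entry (A ^ n) k k = entry (B ^ n) k k := ih1 k k (by omega)
        have e3 := ih2 hd k l hkl
        rw [e1, e2, ← sub_mul, ← mul_sub, e3, hdiag, Finset.sum_range_succ]
        have : ∑ m ∈ Finset.range n, entry B k k ^ m * entry B l l ^ (n + 1 - 1 - m)
            = (∑ m ∈ Finset.range n, entry B k k ^ m * entry B l l ^ (n - 1 - m)) *
              entry B l l := by
          rw [Finset.sum_mul]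
          refine Finset.sum_congr rfl fun m hm => ?_
          have := Finset.mem_range.mp hm
          rw [mul_assoc, ← pow_succ]
          congr 2
          omega
        rw [this]
        simp
        ring
      · intro x hx hne
        have := Finset.mem_Icc.mp hx
        have h1 := hne.1
        have h2 := hne.2
        rw [ih1 k x (by omega), h x l (by omega), sub_self]
      · intro hx
        exact absurd (Finset.mem_Icc.mpr ⟨le_rfl, hlk.le⟩) hx
      · intro hx
        exact absurd (Finset.mem_Icc.mpr ⟨hlk.le, le_rfl⟩) hx

/-- The divided difference of the exponential function does not vanish at two logarithms. -/
theorem hasSum_expDiff (a b : ℂ) (hab : Complex.exp a = Complex.exp b → a = b) :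
    ∃ c : ℂ, c ≠ 0 ∧ HasSum (fun n : ℕ =>
      (∑ m ∈ Finset.range n, a ^ m * b ^ (n - 1 - m)) / (n.factorial : ℂ)) c := by
  have hexp : ∀ x : ℂ, HasSum (fun n : ℕ => x ^ n / (n.factorial : ℂ)) (Complex.exp x) := by
    intro x
    rw [Complex.exp_eq_exp_ℂ]
    exact NormedSpace.expSeries_div_hasSum_exp x
  by_cases h : a = b
  · subst h
    refine ⟨Complex.exp a, Complex.exp_ne_zero a, ?_⟩
    have h1 : (fun n : ℕ => (∑ m ∈ Finset.range n, a ^ m * a ^ (n - 1 - m)) / (n.factorial : ℂ))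
        = fun n : ℕ => (n : ℂ) * a ^ (n - 1) / (n.factorial : ℂ) := by
      funext n
      rw [geom_sum₂_self]
    rw [h1, ← hasSum_nat_add_iff' 1]
    have h2 : (fun n : ℕ => ((n + 1 : ℕ) : ℂ) * a ^ (n + 1 - 1) / ((n + 1).factorial : ℂ))
        = fun n : ℕ => a ^ n / (n.factorial : ℂ) := by
      funext n
      rw [Nat.factorial_succ, Nat.add_sub_cancel]
      have h3 : ((n + 1 : ℕ) : ℂ) ≠ 0 := Nat.cast_ne_zero.mpr (Nat.succ_ne_zero n)
      push_cast at h3 ⊢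
      rw [mul_div_mul_left _ _ h3]
    rw [h2]
    simpa using hexp a
  · refine ⟨(Complex.exp a - Complex.exp b) / (a - b),
      div_ne_zero (sub_ne_zero.mpr fun h' => h (hab h')) (sub_ne_zero.mpr h), ?_⟩
    have h1 := ((hexp a).sub (hexp b)).div_const (a - b)
    refine (congrArg (fun F => HasSum F _) (funext fun n => ?_)).mp h1
    rw [← sub_div, ← geom_sum₂_mul, div_right_comm, mul_div_cancel_right₀ _ (sub_ne_zero.mpr h)]

/-- The matrix with the entries `f i j` for `j ≤ i`. -/
def ofEntries (f : ℤ → ℤ → ℂ) : LowerTri where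
  toFun := fun i j => if OrderDual.ofDual j ≤ OrderDual.ofDual i then
    f (OrderDual.ofDual i) (OrderDual.ofDual j) else 0
  eq_zero_of_not_le' := fun _ _ h => if_neg h

theorem entry_ofEntries (f : ℤ → ℤ → ℂ) {i j : ℤ} (h : j ≤ i) : entry (ofEntries f) i j = f i j :=
  if_pos h

/-- Every invertible lower triangular matrix is the exponential of a lower triangular matrix. -/
theorem exists_isExp (g : LowerTriˣ) : ∃ A : LowerTri, IsExp A (g : LowerTri) := by
  have hg : ∀ i : ℤ, entry (g : LowerTri) i i ≠ 0 := by
    intro i h0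
    have h1 : entry ((g : LowerTri) * ((g⁻¹ : LowerTriˣ) : LowerTri)) i i = 1 := by
      rw [Units.mul_inv, entry_one, if_pos rfl]
    rw [entry_mul] at h1
    simp [h0] at h1
  have hdiagpow : ∀ (M : LowerTri) (n : ℕ) (k : ℤ), entry (M ^ n) k k = entry M k k ^ n := by
    intro M n k
    induction n with
    | zero => simp [entry_one]
    | succ n ih => rw [pow_succ, entry_mul]; simp [ih, pow_succ]
  have hstep : ∀ (d : ℕ) (B : LowerTri), ∃ A : LowerTri,
      (∀ i, entry B i i = Complex.log (entry (g : LowerTri) i i)) → 0 < d →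
      (∀ k l : ℤ, k - l < d → entry A k l = entry B k l) ∧
      ∀ i j : ℤ, i - j = d →
        HasSum (fun n : ℕ => entry (A ^ n) i j / (n.factorial : ℂ)) (entry (g : LowerTri) i j) := by
    intro d B
    by_cases hB : (∀ i, entry B i i = Complex.log (entry (g : LowerTri) i i)) ∧ 0 < d
    swap
    · exact ⟨B, fun h1 h2 => absurd ⟨h1, h2⟩ hB⟩
    obtain ⟨hB, hd⟩ := hB
    have hc : ∀ i j : ℤ, ∃ c : ℂ, c ≠ 0 ∧ HasSum (fun n : ℕ =>
        (∑ m ∈ Finset.range n, entry B i i ^ m * entry B j j ^ (n - 1 - m)) /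
          (n.factorial : ℂ)) c := by
      intro i j
      apply hasSum_expDiff
      rw [hB, hB, Complex.exp_log (hg i), Complex.exp_log (hg j)]
      intro h
      rw [h]
    choose c hc0 hcs using hc
    let f : ℤ → ℤ → ℂ := fun i j => if i - j = d then entry B i j + (entry (g : LowerTri) i j -
      ∑' n : ℕ, entry (B ^ n) i j / (n.factorial : ℂ)) / c i j else entry B i j
    refine ⟨ofEntries f, fun _ _ => ?_⟩
    have h1 : ∀ k l : ℤ, k - l < d → entry (ofEntries f) k l = entry B k l := by
      intro k l hkl
      by_cases h : l ≤ k
      · rw [entry_ofEntries f h]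
        exact if_neg (by omega)
      · rw [entry_of_lt _ (not_le.mp h), entry_of_lt _ (not_le.mp h)]
    refine ⟨h1, fun i j hij => ?_⟩
    have h2 : entry (ofEntries f) i j - entry B i j = (entry (g : LowerTri) i j -
      ∑' n : ℕ, entry (B ^ n) i j / (n.factorial : ℂ)) / c i j := by
      rw [entry_ofEntries f (by omega)]
      simp only [f]
      rw [if_pos hij]
      ring
    have h3 := ((hcs i j).mul_right (entry (ofEntries f) i j - entry B i j)).add
      (summable_exp B i j).hasSum
    rw [h2, mul_div_cancel₀ _ (hc0 i j), sub_add_cancel] at h3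
    refine (congrArg (fun F => HasSum F _) (funext fun n => ?_)).mp h3
    have h4 := (entry_pow_sub (ofEntries f) B d h1 n).2 hd i j hij
    rw [← h2, div_mul_eq_mul_div, ← h4, ← add_div, sub_add_cancel]
  choose next hnext using hstep
  let A0 : LowerTri := ofEntries fun i j => if i = j then Complex.log (entry (g : LowerTri) i i) else 0
  let seq : ℕ → LowerTri := fun d => Nat.rec A0 (fun d B => next (d + 1) B) d
  have hseq : ∀ d, seq (d + 1) = next (d + 1) (seq d) := fun _ => rfl
  have hlog : ∀ d i, entry (seq d) i i = Complex.log (entry (g : LowerTri) i i) := by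
    intro d
    induction d with
    | zero =>
      intro i
      change entry A0 i i = _
      rw [entry_ofEntries _ le_rfl, if_pos rfl]
    | succ d ih =>
      intro i
      rw [hseq, (hnext (d + 1) (seq d) ih (Nat.succ_pos d)).1 i i (by push_cast; omega), ih]
  have hsum : ∀ (d : ℕ) (i j : ℤ), i - j = d →
      HasSum (fun n : ℕ => entry (seq d ^ n) i j / (n.factorial : ℂ)) (entry (g : LowerTri) i j) := by
    intro d i j hij
    cases d with
    | zero =>
      obtain rfl : i = j := by push_cast at hij; omega
      simp only [hdiagpow, hlog]
      have := NormedSpace.expSeries_div_hasSum_exp (Complex.log (entry (g : LowerTri) i i))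
      rwa [← Complex.exp_eq_exp_ℂ, Complex.exp_log (hg i)] at this
    | succ d =>
      rw [hseq]
      exact (hnext (d + 1) (seq d) (hlog d) (Nat.succ_pos d)).2 i j hij
  have hstab : ∀ (e d : ℕ) (k l : ℤ), k - l ≤ d → entry (seq (d + e)) k l = entry (seq d) k l := by
    intro e
    induction e with
    | zero => intro d k l _; rfl
    | succ e ih =>
      intro d k l hkl
      rw [← ih d k l hkl, ← add_assoc, hseq]
      exact (hnext (d + e + 1) (seq (d + e)) (hlog _) (Nat.succ_pos _)).1 k l (by push_cast; omega)
  refine ⟨ofEntries fun i j => entry (seq (i - j).toNat) i j, fun i j => ?_⟩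
  by_cases hij : j ≤ i
  · have h1 := hsum (i - j).toNat i j (by omega)
    convert h1 using 3 with n
    refine (entry_pow_sub _ _ ((i - j).toNat + 1) ?_ n).1 i j (by push_cast; omega)
    intro k l hkl
    by_cases h : l ≤ k
    · rw [entry_ofEntries _ h]
      have := hstab ((i - j).toNat - (k - l).toNat) (k - l).toNat k l (by omega)
      rw [← this]
      congr 2
      push_cast at hkl
      omega
    · rw [entry_of_lt _ (not_le.mp h), entry_of_lt _ (not_le.mp h)]
  · simp only [entry_of_lt _ (not_le.mp hij), zero_div]
    exact hasSum_zero

/-! ### The fermionic Fock space -/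

/-- A Maya diagram: a set of occupied integer sites that contains only finitely many non-negative
integers and all but finitely many negative ones. The diagram with occupied sites
`l₁ > l₂ > l₃ > ⋯` labels the basis state `e_{l₁} ∧ e_{l₂} ∧ e_{l₃} ∧ ⋯`. -/
structure Maya where
  occ : Set ℤ
  finite_pos : {i | i ∈ occ ∧ 0 ≤ i}.Finite
  finite_neg : {i | i ∉ occ ∧ i < 0}.Finite

namespace Maya

/-- The Dirac sea: exactly the negative sites are occupied. -/
def vac : Maya where
  occ := {i | i < 0}
  finite_pos := by
    refine Set.finite_empty.subset ?_
    rintro i ⟨h1, h2⟩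
    exact absurd h1 (not_lt.mpr h2)
  finite_neg := by
    refine Set.finite_empty.subset ?_
    rintro i ⟨h1, h2⟩
    exact absurd h2 h1

/-- Occupy the site `i`. -/
def fill (S : Maya) (i : ℤ) : Maya where
  occ := insert i S.occ
  finite_pos := by
    refine (S.finite_pos.insert i).subset ?_
    rintro j ⟨h1 | h1, h2⟩
    · exact Or.inl h1
    · exact Or.inr ⟨h1, h2⟩
  finite_neg := by
    refine S.finite_neg.subset ?_
    rintro j ⟨h1, h2⟩
    exact ⟨fun h => h1 (Or.inr h), h2⟩

/-- Empty the site `i`. -/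
def clear (S : Maya) (i : ℤ) : Maya where
  occ := S.occ \ {i}
  finite_pos := by
    refine S.finite_pos.subset ?_
    rintro j ⟨h1, h2⟩
    exact ⟨h1.1, h2⟩
  finite_neg := by
    refine (S.finite_neg.insert i).subset ?_
    rintro j ⟨h1, h2⟩
    by_cases hj : j = i
    · exact Or.inl hj
    · exact Or.inr ⟨fun h => h1 ⟨h, hj⟩, h2⟩

/-- The sign `(-1)^#{j occupied, j > i}` for moving `e_i` past the larger factors of the wedge. -/
def sgn (S : Maya) (i : ℤ) : ℂ := (-1) ^ {j | j ∈ S.occ ∧ i < j}.ncard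

end Maya

/-- Formal (possibly infinite) linear combinations of the basis states: `v S` is the coefficient
of the basis state labelled by `S`. -/
abbrev Fock : Type := Maya → ℂ

open Classical in
/-- The basis state labelled by `S`. -/
def ket (S : Maya) : Fock := fun T => if T = S then 1 else 0

/-- The vacuum expectation value `⟨0|v`. -/
def bra0 (v : Fock) : ℂ := v Maya.vac

open Classical in
/-- The creation operator `ψ_i = e_i ∧`. It sends the state of `S` to `sgn S i` times the state of
`S.fill i` if `i` is empty in `S`, and to `0` otherwise; hence the coefficients of `ψ_i v`. -/
def psi (i : ℤ) (v : Fock) : Fock :=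
  fun T => if i ∈ T.occ then (T.clear i).sgn i * v (T.clear i) else 0

open Classical in
/-- The annihilation operator `ψ*_i`, the interior product with the dual of `e_i`. It sends the
state of `S` to `sgn S i` times the state of `S.clear i` if `i` is occupied in `S`, and to `0`
otherwise; hence the coefficients of `ψ*_i v`. -/
def psiStar (i : ℤ) (v : Fock) : Fock :=
  fun T => if i ∈ T.occ then 0 else (T.fill i).sgn i * v (T.fill i)

/-- The normally ordered product `:ψ_i ψ*_j: = ψ_i ψ*_j - ⟨0|ψ_i ψ*_j|0⟩`: the operator that
annihilates the vacuum is put on the right. -/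
def normalOrdered (i j : ℤ) (v : Fock) : Fock :=
  if 0 ≤ j then psi i (psiStar j v) else -psiStar j (psi i v)

/-- The operator `∑_{i,j} A_{ij} :ψ_i ψ*_j:`. For lower triangular `A` each coefficient of the
result is a finite sum. -/
def secondQuant (A : LowerTri) (v : Fock) : Fock :=
  fun T => ∑ᶠ p : ℤ × ℤ, entry A p.1 p.2 * normalOrdered p.1 p.2 v T

/-- The operator `ĝ = exp (∑_{i,j} A_{ij} :ψ_i ψ*_j:)` representing `g = e^A`; the exponential
series converges absolutely in each coefficient. -/
def cliffordExp (A : LowerTri) (v : Fock) : Fock :=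
  fun T => ∑' n : ℕ, ((secondQuant A)^[n] v) T / (n.factorial : ℂ)

/-! ### Formal series -/

/-- Formal series `∑_{j ∈ ℤ} f_j z^j`. -/
abbrev Series : Type := ℤ → ℂ

/-- Formal series `∑_{m,n ∈ ℤ} F_{m,n} z^m w^n`. -/
abbrev BiSeries : Type := ℤ → ℤ → ℂ

/-- The product `f(z) h(w)`. -/
def tensor (f h : Series) : BiSeries := fun m n => f m * h n

/-- The product `z^a w^b F(z,w)`. -/
def shift (a b : ℤ) (F : BiSeries) : BiSeries := fun m n => F (m - a) (n - b)

/-- `F(w,z)` as a series in `z`, `w`. -/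
def swap (F : BiSeries) : BiSeries := fun m n => F n m

/-- The family `F` of formal series has the formal sum `S`: for each monomial only finitely many
members have a nonzero coefficient, and these add up to the coefficient of `S`. -/
def HasFormalSum {ι : Type} (F : ι → BiSeries) (S : BiSeries) : Prop :=
  ∀ m n : ℤ, {p | F p m n ≠ 0}.Finite ∧ ∑ᶠ p, F p m n = S m n

/-! ### Adapted bases, recursion matrix and pair correlator -/

/-- `w^g_k(z) = g(z^{k-1}) = ∑_j g_{-j-1,-k} z^j`, where `e_i = z^{-i-1}`. -/
def adapted (g : LowerTriˣ) (k : ℤ) : Series :=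
  fun j => entry (g : LowerTri) (-j - 1) (-k)

/-- The dual basis `w^{g*}_k(z) = ∑_j (g⁻¹)_{k-1,j} z^j`. -/
def adaptedDual (g : LowerTriˣ) (k : ℤ) : Series :=
  fun j => entry ((g⁻¹ : LowerTriˣ) : LowerTri) (k - 1) j

/-- The recursion matrix `Q̃⁺_{kj} = ∑_{i=-k-1}^{-j} (g⁻¹)_{-j,i} g_{i+1,-k}`, which is zero for
`j > k + 1`. -/
def recMatrix (g : LowerTriˣ) (k j : ℤ) : ℂ :=
  ∑ i ∈ Finset.Icc (-k - 1) (-j),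
    entry ((g⁻¹ : LowerTriˣ) : LowerTri) (-j) i * entry (g : LowerTri) (i + 1) (-k)

/-- The pair correlator `⟨0|ψ(z) ψ*(w) ĝ|0⟩` in the region `|z| > |w|`, as a formal series, for
`ψ(z) = ∑_i ψ_i z^i` and `ψ*(w) = ∑_i ψ*_i w^{-i-1}`. -/
def pairCorrOuter (A : LowerTri) : BiSeries :=
  fun m n => bra0 (psi m (psiStar (-n - 1) (cliffordExp A (ket Maya.vac))))

/-- The pair correlator `-⟨0|ψ*(w) ψ(z) ĝ|0⟩` in the region `|z| < |w|`, as a formal series. -/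
def pairCorrInner (A : LowerTri) : BiSeries :=
  fun m n => -bra0 (psiStar (-n - 1) (psi m (cliffordExp A (ket Maya.vac))))

end FermionicCD

end

/-!
For a Fock vector `v` let `X(v)` be the matrix with the entries `X(v)_{ba} = ⟨0|ψ_a ψ*_b v⟩`
(`corrMatrix`). It is lower triangular, and it is the projector `P` onto the negative sites for
`v = |0⟩`. The anticommutation relations give
`[ψ_a ψ*_b, ψ_i ψ*_j] = δ_{bi} ψ_a ψ*_j - δ_{aj} ψ_i ψ*_b`, and `⟨0| :ψ_i ψ*_j: = 0` for `j ≤ i`.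
So the operator `∑ A_{ij} :ψ_i ψ*_j:` acts on `X` as the commutator with `A`
(`corrMatrix_secondQuant`), and exponentiating yields `X(ĝ|0⟩) = R` with `R = g P g⁻¹`
(`corrMatrix_cliffordExp`). The correlator in the region `|z| > |w|` therefore has the entries of
`R` as its coefficients, and the other expansion differs from it by the formal delta function,
because `⟨0|ĝ|0⟩ = 1`.

Let `Λ` be the shift `e_i ↦ e_{i+1}` and `R' = Λ⁻¹ R Λ`. Multiplication of the correlator by `z - w`
turns `R` into `R' - R`, up to a reindexing, and kills the delta function. Now
`R' - R = (1 - R) R' - R (1 - R')`. Here `1 - R = g (1 - P) g⁻¹`, and the entries of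
`W = g⁻¹ Λ⁻¹ g Λ` are those of `Q̃⁺`. Hence the first term is the double sum over `i, j ≥ 0`
(`hasFormalSum_kernelSum`). In the second term `W` is compressed to the rows `i < 0` and the columns
`j ≥ -1`; being lower triangular, it contributes only its entry at `(-1, -1)`, which is the
correction term `Q̃⁺_{01}` (`correction_eq`). Division by `z - w` is a telescoping sum, since
the two correlators vanish far out in the respective directions.
-/

noncomputable section

namespace FermionicCD

/-! ### Canonical anticommutation relations -/

namespace Maya

@[ext] theorem ext' {S T : Maya} (h : ∀ i, i ∈ S.occ ↔ i ∈ T.occ) : S = T := by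
  cases S; cases T
  congr
  exact Set.ext h

theorem mem_fill {S : Maya} {i j : ℤ} : j ∈ (S.fill i).occ ↔ j = i ∨ j ∈ S.occ := by
  constructor <;> exact id

theorem mem_clear {S : Maya} {i j : ℤ} : j ∈ (S.clear i).occ ↔ j ∈ S.occ ∧ j ≠ i := by
  constructor <;> exact id

theorem mem_vac {i : ℤ} : i ∈ vac.occ ↔ i < 0 := Iff.rfl

theorem clear_comm (S : Maya) (i j : ℤ) : (S.clear i).clear j = (S.clear j).clear i := by
  ext k; simp only [mem_clear]; tauto

theorem fill_comm (S : Maya) (i j : ℤ) : (S.fill i).fill j = (S.fill j).fill i := by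
  ext k; simp only [mem_fill]; tauto

theorem clear_fill_comm (S : Maya) {i j : ℤ} (h : i ≠ j) :
    (S.clear i).fill j = (S.fill j).clear i := by
  ext k; simp only [mem_fill, mem_clear]
  by_cases hk : k = j
  · subst hk; simp [h.symm]
  · simp [hk]

theorem fill_clear_self {S : Maya} {i : ℤ} (h : i ∈ S.occ) : (S.clear i).fill i = S := by
  ext k; simp only [mem_fill, mem_clear]
  by_cases hk : k = i
  · subst hk; simp [h]
  · simp [hk]

theorem clear_fill_self {S : Maya} {i : ℤ} (h : i ∉ S.occ) : (S.fill i).clear i = S := by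
  ext k; simp only [mem_fill, mem_clear]
  by_cases hk : k = i
  · subst hk; simp [h]
  · simp [hk]

theorem finite_above (S : Maya) (i : ℤ) : {j | j ∈ S.occ ∧ i < j}.Finite := by
  refine (S.finite_pos.union (Set.finite_Ioo i 0)).subset ?_
  rintro j ⟨h1, h2⟩
  rcases le_or_gt 0 j with h | h
  · exact Or.inl ⟨h1, h⟩
  · exact Or.inr ⟨h2, h⟩

theorem sgn_fill {S : Maya} {i : ℤ} (h : i ∉ S.occ) (j : ℤ) :
    (S.fill i).sgn j = (if j < i then -1 else 1) * S.sgn j := by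
  unfold sgn
  split_ifs with hji
  · have : {k | k ∈ (S.fill i).occ ∧ j < k} = insert i {k | k ∈ S.occ ∧ j < k} := by
      ext k
      simp only [mem_fill, Set.mem_ofPred_eq, Set.mem_insert_iff]
      constructor
      · tauto
      · rintro (rfl | h)
        · exact ⟨Or.inl rfl, hji⟩
        · tauto
    rw [this, Set.ncard_insert_of_notMem (fun h' => h h'.1) (S.finite_above j), pow_succ]
    ring
  · have : {k | k ∈ (S.fill i).occ ∧ j < k} = {k | k ∈ S.occ ∧ j < k} := by
      ext k
      simp only [mem_fill, Set.mem_ofPred_eq]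
      constructor
      · rintro ⟨rfl | h1, h2⟩
        · exact absurd h2 hji
        · exact ⟨h1, h2⟩
      · tauto
    rw [this, one_mul]

theorem sgn_clear {S : Maya} {i : ℤ} (h : i ∈ S.occ) (j : ℤ) :
    (S.clear i).sgn j = (if j < i then -1 else 1) * S.sgn j := by
  have h1 := sgn_fill (S := S.clear i) (i := i) (fun h' => (mem_clear.mp h').2 rfl) j
  rw [fill_clear_self h] at h1
  rw [h1]
  split_ifs <;> ring

theorem sgn_mul_self (S : Maya) (i : ℤ) : S.sgn i * S.sgn i = 1 := by
  unfold sgn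
  rw [← mul_pow]
  simp

end Maya

open Maya

theorem psi_of_mem {i : ℤ} {T : Maya} (h : i ∈ T.occ) (v : Fock) :
    psi i v T = T.sgn i * v (T.clear i) := by
  unfold psi
  rw [if_pos h, sgn_clear h, if_neg (lt_irrefl i), one_mul]

theorem psi_of_notMem {i : ℤ} {T : Maya} (h : i ∉ T.occ) (v : Fock) : psi i v T = 0 := by
  unfold psi
  rw [if_neg h]

theorem psiStar_of_mem {i : ℤ} {T : Maya} (h : i ∈ T.occ) (v : Fock) : psiStar i v T = 0 := by
  unfold psiStar
  rw [if_pos h]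

theorem psiStar_of_notMem {i : ℤ} {T : Maya} (h : i ∉ T.occ) (v : Fock) :
    psiStar i v T = T.sgn i * v (T.fill i) := by
  unfold psiStar
  rw [if_neg h, sgn_fill h, if_neg (lt_irrefl i), one_mul]

/-- The creation operator `ψ_i` as an element of the endomorphism ring of the Fock space. -/
def creation (i : ℤ) : Module.End ℂ Fock where
  toFun := psi i
  map_add' u v := by
    funext T
    by_cases h : i ∈ T.occ
    · simp only [psi_of_mem h, Pi.add_apply, mul_add]
    · simp only [psi_of_notMem h, Pi.add_apply, add_zero]
  map_smul' c v := by
    funext T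
    by_cases h : i ∈ T.occ
    · simp only [psi_of_mem h, Pi.smul_apply, smul_eq_mul, RingHom.id_apply, mul_left_comm]
    · simp only [psi_of_notMem h, Pi.smul_apply, smul_zero]

/-- The annihilation operator `ψ*_i` as an element of the endomorphism ring of the Fock space. -/
def annihilation (i : ℤ) : Module.End ℂ Fock where
  toFun := psiStar i
  map_add' u v := by
    funext T
    by_cases h : i ∈ T.occ
    · simp only [psiStar_of_mem h, Pi.add_apply, add_zero]
    · simp only [psiStar_of_notMem h, Pi.add_apply, mul_add]
  map_smul' c v := by
    funext T
    by_cases h : i ∈ T.occ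
    · simp only [psiStar_of_mem h, Pi.smul_apply, smul_zero]
    · simp only [psiStar_of_notMem h, Pi.smul_apply, smul_eq_mul, RingHom.id_apply, mul_left_comm]

theorem creation_apply (i : ℤ) (v : Fock) : creation i v = psi i v := rfl

theorem annihilation_apply (i : ℤ) (v : Fock) : annihilation i v = psiStar i v := rfl

theorem creation_mul_creation (i j : ℤ) :
    creation i * creation j = -(creation j * creation i) := by
  ext v T
  simp only [Module.End.mul_apply, LinearMap.neg_apply, Pi.neg_apply, creation_apply]
  rcases eq_or_ne i j with rfl | hij
  · have h : psi i (psi i v) T = 0 := by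
      by_cases hi : i ∈ T.occ
      · rw [psi_of_mem hi, psi_of_notMem (fun h => (mem_clear.mp h).2 rfl), mul_zero]
      · rw [psi_of_notMem hi]
    rw [h, neg_zero]
  by_cases hi : i ∈ T.occ <;> by_cases hj : j ∈ T.occ
  · rw [psi_of_mem hi, psi_of_mem hj, psi_of_mem (mem_clear.mpr ⟨hj, hij.symm⟩),
      psi_of_mem (mem_clear.mpr ⟨hi, hij⟩), clear_comm T j i, sgn_clear hi, sgn_clear hj]
    rcases lt_or_gt_of_ne hij with h | h
    · rw [if_pos h, if_neg h.not_gt]; ring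
    · rw [if_pos h, if_neg h.not_gt]; ring
  · rw [psi_of_mem hi, psi_of_notMem (fun h => hj (mem_clear.mp h).1), psi_of_notMem hj]
    simp
  · rw [psi_of_mem hj, psi_of_notMem hi, psi_of_notMem (fun h => hi (mem_clear.mp h).1)]
    simp
  · rw [psi_of_notMem hi, psi_of_notMem hj, neg_zero]

theorem annihilation_mul_annihilation (i j : ℤ) :
    annihilation i * annihilation j = -(annihilation j * annihilation i) := by
  ext v T
  simp only [Module.End.mul_apply, LinearMap.neg_apply, Pi.neg_apply, annihilation_apply]
  rcases eq_or_ne i j with rfl | hij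
  · have h : psiStar i (psiStar i v) T = 0 := by
      by_cases hi : i ∈ T.occ
      · rw [psiStar_of_mem hi]
      · rw [psiStar_of_notMem hi, psiStar_of_mem (mem_fill.mpr (Or.inl rfl)), mul_zero]
    rw [h, neg_zero]
  by_cases hi : i ∈ T.occ <;> by_cases hj : j ∈ T.occ
  · rw [psiStar_of_mem hi, psiStar_of_mem hj, neg_zero]
  · rw [psiStar_of_mem hi, psiStar_of_notMem hj, psiStar_of_mem (mem_fill.mpr (Or.inr hi))]
    simp
  · rw [psiStar_of_mem hj, psiStar_of_notMem hi, psiStar_of_mem (mem_fill.mpr (Or.inr hj))]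
    simp
  · rw [psiStar_of_notMem hi, psiStar_of_notMem hj,
      psiStar_of_notMem (fun h => (mem_fill.mp h).elim hij.symm hj),
      psiStar_of_notMem (fun h => (mem_fill.mp h).elim hij hi), fill_comm T j i,
      sgn_fill hi, sgn_fill hj]
    rcases lt_or_gt_of_ne hij with h | h
    · rw [if_pos h, if_neg h.not_gt]; ring
    · rw [if_pos h, if_neg h.not_gt]; ring

theorem annihilation_mul_creation (j i : ℤ) :
    annihilation j * creation i = (if j = i then 1 else 0) - creation i * annihilation j := by
  ext v T
  rcases eq_or_ne j i with rfl | hij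
  · simp only [if_true, Module.End.mul_apply, LinearMap.sub_apply, Pi.sub_apply, creation_apply,
      annihilation_apply, Module.End.one_apply]
    by_cases h : j ∈ T.occ
    · rw [psiStar_of_mem h, psi_of_mem h, psiStar_of_notMem (fun h => (mem_clear.mp h).2 rfl),
        sgn_clear h, if_neg (lt_irrefl j), fill_clear_self h, one_mul, ← mul_assoc, sgn_mul_self]
      ring
    · rw [psi_of_notMem h, psiStar_of_notMem h, psi_of_mem (mem_fill.mpr (Or.inl rfl)),
        sgn_fill h, if_neg (lt_irrefl j), clear_fill_self h, one_mul, ← mul_assoc, sgn_mul_self]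
      ring
  · simp only [if_neg hij, Module.End.mul_apply, zero_sub, LinearMap.neg_apply, Pi.neg_apply,
      creation_apply, annihilation_apply]
    by_cases hi : i ∈ T.occ <;> by_cases hj : j ∈ T.occ
    · rw [psiStar_of_mem hj, psi_of_mem hi, psiStar_of_mem (mem_clear.mpr ⟨hj, hij⟩)]
      simp
    · rw [psiStar_of_notMem hj, psi_of_mem hi, psi_of_mem (mem_fill.mpr (Or.inr hi)),
        psiStar_of_notMem (fun h => hj (mem_clear.mp h).1), clear_fill_comm T hij.symm,
        sgn_fill hj, sgn_clear hi]
      rcases lt_or_gt_of_ne hij with h | h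
      · rw [if_pos h, if_neg h.not_gt]; ring
      · rw [if_pos h, if_neg h.not_gt]; ring
    · rw [psiStar_of_mem hj, psi_of_notMem hi, neg_zero]
    · rw [psiStar_of_notMem hj, psi_of_notMem hi,
        psi_of_notMem (fun h => (mem_fill.mp h).elim hij.symm hi)]
      simp

/-- For both signs of `j` the normally ordered product is `ψ_i ψ*_j` minus a scalar, so it has the
same commutators as `ψ_i ψ*_j`. -/
theorem normalOrdered_eq (i j : ℤ) (v : Fock) :
    normalOrdered i j v =
      (creation i * annihilation j - if 0 ≤ j then 0 else if j = i then 1 else 0) v := by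
  unfold normalOrdered
  by_cases h1 : 0 ≤ j
  · simp [h1, creation_apply, annihilation_apply]
  · have h2 := congrArg (fun f : Module.End ℂ Fock => -(f v)) (annihilation_mul_creation j i)
    simp only [Module.End.mul_apply, creation_apply, annihilation_apply] at h2
    rw [if_neg h1, if_neg h1, h2]
    simp [creation_apply, annihilation_apply]

/-- The ring identity behind `[ψ_a ψ*_b, ψ_i ψ*_j] = δ_{bi} ψ_a ψ*_j - δ_{aj} ψ_i ψ*_b`. -/
theorem mul_mul_mul_eq_of_anticomm {R : Type*} [Ring R] {p q s t d e : R}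
    (hsq : s * q = d - q * s) (hpq : p * q = -(q * p)) (hst : s * t = -(t * s))
    (htp : t * p = e - p * t) :
    p * s * (q * t) = q * t * (p * s) + (p * d * t - q * e * s) := by
  calc p * s * (q * t) = p * (s * q) * t := by simp only [mul_assoc]
    _ = p * d * t - p * q * (s * t) := by rw [hsq]; simp only [mul_sub, sub_mul, mul_assoc]
    _ = p * d * t - q * (p * t) * s := by rw [hpq, hst]; simp only [neg_mul_neg, mul_assoc]
    _ = p * d * t - q * (e - t * p) * s := by rw [htp, sub_sub_cancel]
    _ = _ := by simp only [mul_sub, sub_mul, mul_assoc]; abel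

theorem bilinear_commutator (a b i j : ℤ) :
    creation a * annihilation b * (creation i * annihilation j) =
      creation i * annihilation j * (creation a * annihilation b) +
      ((if b = i then creation a * annihilation j else 0) -
        (if a = j then creation i * annihilation b else 0)) := by
  rw [mul_mul_mul_eq_of_anticomm (annihilation_mul_creation b i) (creation_mul_creation a i)
    (annihilation_mul_annihilation b j) (annihilation_mul_creation j a)]
  simp only [eq_comm (a := j), mul_ite, ite_mul, mul_one, mul_zero, zero_mul]

/-! ### The equation of motion of the pair correlation matrix -/

theorem bra0_psi {i : ℤ} (h : 0 ≤ i) (v : Fock) : bra0 (psi i v) = 0 := by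
  exact psi_of_notMem (fun h' => absurd (mem_vac.mp h') (not_lt.mpr h)) v

theorem bra0_psiStar {i : ℤ} (h : i < 0) (v : Fock) : bra0 (psiStar i v) = 0 := by
  exact psiStar_of_mem (mem_vac.mpr h) v

theorem bra0_normalOrdered {i j : ℤ} (h : j ≤ i) (v : Fock) : bra0 (normalOrdered i j v) = 0 := by
  unfold normalOrdered
  split_ifs with hj
  · exact bra0_psi (hj.trans h) _
  · have := bra0_psiStar (not_le.mp hj) (psi i v)
    simpa [bra0] using this

theorem bra0_psiStar_psi (a b : ℤ) (v : Fock) :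
    bra0 (psiStar b (psi a v)) = (if b = a then bra0 v else 0) - bra0 (psi a (psiStar b v)) := by
  have h := congrArg (fun f : Module.End ℂ Fock => bra0 (f v)) (annihilation_mul_creation b a)
  simp only [Module.End.mul_apply, creation_apply, annihilation_apply] at h
  rw [h]
  split_ifs <;> simp [bra0, creation_apply, annihilation_apply]

/-- The matrix `X(v)_{ba} = ⟨0|ψ_a ψ*_b v⟩`. These matrix elements vanish for `b < a`, whatever `v`
is, so that nothing is lost in regarding `X(v)` as lower triangular. -/
def corrMatrix (v : Fock) : LowerTri := ofEntries fun b a => bra0 (psi a (psiStar b v))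

theorem entry_corrMatrix (v : Fock) (b a : ℤ) :
    entry (corrMatrix v) b a = bra0 (psi a (psiStar b v)) := by
  rcases le_or_gt a b with h | h
  · exact entry_ofEntries _ h
  · rw [entry_of_lt _ h]
    rcases le_or_gt 0 a with ha | ha
    · rw [bra0_psi ha]
    · have h1 := bra0_psiStar_psi a b v
      rw [bra0_psiStar (h.trans ha), if_neg h.ne] at h1
      linear_combination -h1

theorem bra0_psi_psiStar_normalOrdered (a b : ℤ) {i j : ℤ} (h : j ≤ i) (v : Fock) :
    bra0 (psi a (psiStar b (normalOrdered i j v))) =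
      (if b = i then entry (corrMatrix v) j a else 0) -
        (if a = j then entry (corrMatrix v) b i else 0) := by
  have h0 := bra0_normalOrdered h (psi a (psiStar b v))
  rw [normalOrdered_eq] at h0 ⊢
  have h1 := congrArg (fun f : Module.End ℂ Fock => bra0 (f v)) (bilinear_commutator a b i j)
  simp only [entry_corrMatrix]
  simp only [← creation_apply, ← annihilation_apply] at h0 h1 ⊢
  set c : Module.End ℂ Fock := if 0 ≤ j then 0 else if j = i then 1 else 0 with hc
  have hcomm : creation a (annihilation b (c v)) = c (creation a (annihilation b v)) := by
    rw [hc]; split_ifs <;> simp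
  have hR : bra0 (((if b = i then creation a * annihilation j else 0) -
        (if a = j then creation i * annihilation b else 0) : Module.End ℂ Fock) v) =
      (if b = i then bra0 (creation a (annihilation j v)) else 0) -
        (if a = j then bra0 (creation i (annihilation b v)) else 0) := by
    split_ifs <;> simp [bra0]
  rw [← hR]
  simp only [LinearMap.sub_apply, Module.End.mul_apply, LinearMap.add_apply, map_sub, hcomm]
    at h0 h1 ⊢
  simp only [bra0, Pi.sub_apply, Pi.add_apply] at h0 h1 ⊢
  linear_combination h0 + h1

/-- A two-fermion matrix element of `v` is a multiple of a single coefficient of `v`. Hence it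
commutes with coefficientwise sums, whether or not they converge. -/
theorem exists_bra0_psi_psiStar_eq (a b : ℤ) :
    ∃ (c : ℂ) (T : Maya), ∀ v : Fock, bra0 (psi a (psiStar b v)) = c * v T := by
  by_cases ha : a ∈ vac.occ
  · by_cases hb : b ∈ (vac.clear a).occ
    · exact ⟨0, vac, fun v => by rw [bra0, psi_of_mem ha, psiStar_of_mem hb]; ring⟩
    · exact ⟨vac.sgn a * (vac.clear a).sgn b, (vac.clear a).fill b, fun v => by
        rw [bra0, psi_of_mem ha, psiStar_of_notMem hb]; ring⟩
  · exact ⟨0, vac, fun v => by rw [bra0, psi_of_notMem ha]; ring⟩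

/-- Equation of motion. For lower triangular `A` every `:ψ_i ψ*_j:` that occurs satisfies
`⟨0| :ψ_i ψ*_j: = 0`, so only its commutator with `ψ_a ψ*_b` survives. -/
theorem corrMatrix_secondQuant (A : LowerTri) (v : Fock) :
    corrMatrix (secondQuant A v) = A * corrMatrix v - corrMatrix v * A := by
  have key : ∀ b a : ℤ, entry (corrMatrix (secondQuant A v)) b a =
      entry (A * corrMatrix v) b a - entry (corrMatrix v * A) b a := by
    intro b a
    obtain ⟨c, T, hc⟩ := exists_bra0_psi_psiStar_eq a b
    have h1 : ∀ p : ℤ × ℤ, c * (entry A p.1 p.2 * normalOrdered p.1 p.2 v T) =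
        entry A p.1 p.2 * ((if b = p.1 then entry (corrMatrix v) p.2 a else 0) -
          (if a = p.2 then entry (corrMatrix v) b p.1 else 0)) := by
      intro p
      rcases le_or_gt p.2 p.1 with h | h
      · rw [← bra0_psi_psiStar_normalOrdered a b h, hc]; ring
      · rw [entry_of_lt _ h]; ring
    rw [entry_corrMatrix, hc, secondQuant, ← smul_eq_mul, smul_finsum]
    simp only [smul_eq_mul, h1]
    rw [finsum_eq_sum_of_support_subset (s := Finset.Icc a b ×ˢ Finset.Icc a b),
      Finset.sum_product, entry_mul, entry_mul]
    · simp only [mul_sub, Finset.sum_sub_distrib, mul_ite, mul_zero]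
      congr 1
      · rw [Finset.sum_comm]
        refine Finset.sum_congr rfl fun y hy => ?_
        have := Finset.mem_Icc.mp hy
        rw [Finset.sum_ite_eq, if_pos (Finset.mem_Icc.mpr ⟨by omega, le_rfl⟩)]
      · refine Finset.sum_congr rfl fun y hy => ?_
        have := Finset.mem_Icc.mp hy
        rw [Finset.sum_ite_eq, if_pos (Finset.mem_Icc.mpr ⟨le_rfl, by omega⟩), mul_comm]
    · rintro ⟨i, j⟩ hp
      rw [Function.mem_support] at hp
      simp only [Finset.coe_product, Finset.coe_Icc, Set.mem_prod, Set.mem_Icc]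
      by_contra hcon
      apply hp
      rcases lt_or_ge i j with h | h
      · rw [entry_of_lt _ h, zero_mul]
      have h2 : (if b = i then entry (corrMatrix v) j a else 0) = 0 := by
        split_ifs with hb
        · exact entry_of_lt _ (by omega)
        · rfl
      have h3 : (if a = j then entry (corrMatrix v) b i else 0) = 0 := by
        split_ifs with hb
        · exact entry_of_lt _ (by omega)
        · rfl
      simp only [h2, h3, sub_zero, mul_zero]
  refine IncidenceAlgebra.ext fun x y _ => ?_
  exact key (OrderDual.ofDual x) (OrderDual.ofDual y)

/-! ### Conjugation by the exponential of a lower triangular matrix -/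

theorem lowerTri_ext {a b : LowerTri} (h : ∀ i j : ℤ, entry a i j = entry b i j) : a = b :=
  IncidenceAlgebra.ext fun x y _ => h (OrderDual.ofDual x) (OrderDual.ofDual y)

/-- The entry `g_{ij}` as an additive functional of `g`. -/
def entryHom (i j : ℤ) : LowerTri →+ ℂ where
  toFun g := entry g i j
  map_zero' := rfl
  map_add' _ _ := rfl

theorem entryHom_apply (i j : ℤ) (g : LowerTri) : entryHom i j g = entry g i j := rfl

theorem entry_sub (a b : LowerTri) (i j : ℤ) : entry (a - b) i j = entry a i j - entry b i j := rfl

theorem entry_mul_mul (a b c : LowerTri) (i j : ℤ) :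
    entry (a * b * c) i j =
      ∑ x ∈ Finset.Icc j i, ∑ y ∈ Finset.Icc j i, entry a i x * entry b x y * entry c y j := by
  rw [entry_mul, Finset.sum_comm]
  refine Finset.sum_congr rfl fun y hy => ?_
  have hy' := Finset.mem_Icc.mp hy
  rw [entry_mul, Finset.sum_mul]
  refine Finset.sum_subset (Finset.Icc_subset_Icc_left hy'.1) fun x hx hx' => ?_
  have h1 := Finset.mem_Icc.mp hx
  rw [Finset.mem_Icc] at hx'
  rw [entry_of_lt b (by omega)]
  ring

theorem iterate_mul_add_mul {R : Type*} [Ring R] (A B Y : R) (n : ℕ) :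
    (fun Z => A * Z + Z * B)^[n] Y = ∑ kl ∈ Finset.HasAntidiagonal.antidiagonal n,
      n.choose kl.1 • (A ^ kl.1 * Y * B ^ kl.2) := by
  have h1 : (fun Z => A * Z + Z * B) =
      ⇑(LinearMap.mulLeft ℕ A + LinearMap.mulRight ℕ B : Module.End ℕ R) := rfl
  rw [h1, ← Module.End.coe_pow, (LinearMap.commute_mulLeft_right A B).add_pow',
    LinearMap.sum_apply]
  refine Finset.sum_congr rfl fun kl _ => ?_
  rw [LinearMap.smul_apply, Module.End.mul_apply, LinearMap.pow_mulLeft, LinearMap.pow_mulRight,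
    LinearMap.mulLeft_apply, LinearMap.mulRight_apply, mul_assoc]

/-- The series `∑ₙ (ad)ⁿ(Y) / n!` of the operator `ad : Z ↦ AZ + ZB` converges entrywise to
`exp(A) Y exp(B)`. -/
theorem hasSum_iterate_mul_add_mul {A B g h : LowerTri} (hA : IsExp A g) (hB : IsExp B h)
    (Y : LowerTri) (i j : ℤ) :
    HasSum (fun n : ℕ => entry ((fun Z => A * Z + Z * B)^[n] Y) i j / (n.factorial : ℂ))
      (entry (g * Y * h) i j) := by
  have cauchy : ∀ x y : ℤ, HasSum (fun n : ℕ => ∑ kl ∈ Finset.HasAntidiagonal.antidiagonal n,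
      (entry (A ^ kl.1) i x / (kl.1.factorial : ℂ)) *
        (entry (B ^ kl.2) y j / (kl.2.factorial : ℂ))) (entry g i x * entry h y j) := by
    intro x y
    have h1 := (hA i x).summable.norm
    have h2 := (hB y j).summable.norm
    rw [← (hA i x).tsum_eq, ← (hB y j).tsum_eq,
      tsum_mul_tsum_eq_tsum_sum_antidiagonal_of_summable_norm h1 h2]
    exact (summable_norm_sum_mul_antidiagonal_of_summable_norm h1 h2).of_norm.hasSum
  have h1 := hasSum_sum (s := Finset.Icc j i) fun x _ => hasSum_sum (s := Finset.Icc j i)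
    fun y _ => (cauchy x y).mul_right (entry Y x y)
  have hval : entry (g * Y * h) i j = ∑ x ∈ Finset.Icc j i, ∑ y ∈ Finset.Icc j i,
      entry g i x * entry h y j * entry Y x y := by
    rw [entry_mul_mul]
    exact Finset.sum_congr rfl fun x _ => Finset.sum_congr rfl fun y _ => by ring
  rw [hval]
  refine (congrArg (fun F => HasSum F _) (funext fun n => ?_)).mp h1
  · rw [iterate_mul_add_mul, ← entryHom_apply, map_sum, Finset.sum_div]
    simp only [Finset.sum_mul]
    simp_rw [Finset.sum_comm (t := Finset.HasAntidiagonal.antidiagonal n)]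
    refine Finset.sum_congr rfl fun kl hkl => ?_
    rw [Finset.HasAntidiagonal.mem_antidiagonal] at hkl
    rw [map_nsmul, entryHom_apply, entry_mul_mul, nsmul_eq_mul, Finset.mul_sum, Finset.sum_div]
    refine Finset.sum_congr rfl fun x _ => ?_
    rw [Finset.mul_sum, Finset.sum_div]
    refine Finset.sum_congr rfl fun y _ => ?_
    have h3 : (n.choose kl.1 : ℂ) * (kl.1.factorial * kl.2.factorial) = n.factorial := by
      have h4 := Nat.choose_mul_factorial_mul_factorial (n := n) (k := kl.1) (by omega)
      rw [show n - kl.1 = kl.2 by omega] at h4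
      rw [← h4]
      push_cast
      ring
    have h5 : (kl.1.factorial : ℂ) ≠ 0 := Nat.cast_ne_zero.mpr (Nat.factorial_ne_zero _)
    have h6 : (kl.2.factorial : ℂ) ≠ 0 := Nat.cast_ne_zero.mpr (Nat.factorial_ne_zero _)
    have h7 : (n.factorial : ℂ) ≠ 0 := Nat.cast_ne_zero.mpr (Nat.factorial_ne_zero _)
    field_simp
    linear_combination (-entry (A ^ kl.1) i x * entry (B ^ kl.2) y j * entry Y x y) * h3

theorem isExp_neg_inv {A : LowerTri} {g : LowerTriˣ} (hA : IsExp A (g : LowerTri)) :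
    IsExp (-A) ((g⁻¹ : LowerTriˣ) : LowerTri) := by
  obtain ⟨h, hh⟩ : ∃ h : LowerTri, IsExp (-A) h := by
    refine ⟨ofEntries fun i j => ∑' n : ℕ, entry ((-A) ^ n) i j / (n.factorial : ℂ),
      fun i j => ?_⟩
    rcases le_or_gt j i with hij | hij
    · rw [entry_ofEntries _ hij]
      exact (summable_exp (-A) i j).hasSum
    · simp only [entry_of_lt _ hij, zero_div]
      exact hasSum_zero
  have h1 : (g : LowerTri) * h = 1 := by
    refine lowerTri_ext fun i j => ?_
    have h2 := hasSum_iterate_mul_add_mul hA hh 1 i j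
    rw [mul_one] at h2
    refine h2.unique ?_
    have h3 : ∀ n : ℕ, n ≠ 0 →
        entry ((fun Z => A * Z + Z * (-A))^[n] 1) i j / (n.factorial : ℂ) = 0 := by
      intro n hn
      obtain ⟨m, rfl⟩ := Nat.exists_eq_succ_of_ne_zero hn
      have h4 : (fun Z => A * Z + Z * (-A))^[m] 0 = 0 :=
        Function.iterate_fixed (by simp) m
      rw [Function.iterate_succ_apply, mul_one, one_mul, add_neg_cancel, h4]
      exact zero_div _
    have h4 := hasSum_single 0 h3
    rwa [Function.iterate_zero_apply, Nat.factorial_zero, Nat.cast_one, div_one] at h4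
  rwa [Units.eq_inv_of_mul_eq_one_left h1] at hh

/-! ### The pair correlator as a conjugated projector -/

/-- The projector onto the sites satisfying `p`. -/
def proj (p : ℤ → Prop) [DecidablePred p] : LowerTri :=
  ofEntries fun i j => if i = j ∧ p i then 1 else 0

theorem entry_proj (p : ℤ → Prop) [DecidablePred p] (i j : ℤ) :
    entry (proj p) i j = if i = j ∧ p i then 1 else 0 := by
  rcases le_or_gt j i with h | h
  · exact entry_ofEntries _ h
  · rw [entry_of_lt _ h, if_neg (by omega)]

theorem entry_mul_proj (a : LowerTri) (p : ℤ → Prop) [DecidablePred p] (i j : ℤ) :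
    entry (a * proj p) i j = if p j then entry a i j else 0 := by
  rcases le_or_gt j i with h | h
  · rw [entry_mul, Finset.sum_eq_single j]
    · rw [entry_proj]
      split_ifs <;> simp_all
    · intro x _ hx
      rw [entry_proj, if_neg (by tauto), mul_zero]
    · intro hj
      exact absurd (Finset.mem_Icc.mpr ⟨le_rfl, h⟩) hj
  · rw [entry_of_lt _ h, entry_of_lt _ h, ite_self]

theorem entry_proj_mul (a : LowerTri) (p : ℤ → Prop) [DecidablePred p] (i j : ℤ) :
    entry (proj p * a) i j = if p i then entry a i j else 0 := by
  rcases le_or_gt j i with h | h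
  · rw [entry_mul, Finset.sum_eq_single i]
    · rw [entry_proj]
      split_ifs <;> simp_all
    · intro x _ hx
      rw [entry_proj, if_neg (by tauto), zero_mul]
    · intro hj
      exact absurd (Finset.mem_Icc.mpr ⟨h, le_rfl⟩) hj
  · rw [entry_of_lt _ h, entry_of_lt _ h, ite_self]

theorem bra0_ket_vac : bra0 (ket Maya.vac) = 1 := if_pos rfl

theorem corrMatrix_vac : corrMatrix (ket Maya.vac) = proj (· < 0) := by
  refine lowerTri_ext fun b a => ?_
  rw [entry_corrMatrix, entry_proj]
  rcases le_or_gt 0 a with ha | ha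
  · rw [bra0_psi ha, if_neg (by omega)]
  rcases eq_or_ne b a with rfl | hab
  · have h1 := bra0_psiStar_psi b b (ket Maya.vac)
    rw [bra0_psiStar ha, bra0_ket_vac, if_pos rfl] at h1
    rw [if_pos ⟨rfl, ha⟩]
    linear_combination h1
  · rw [if_neg (by tauto), bra0, psi_of_mem (Maya.mem_vac.mpr ha)]
    have hne : ∀ h : b ∉ (Maya.vac.clear a).occ, (Maya.vac.clear a).fill b ≠ Maya.vac := by
      intro h h'
      have h2 : a ∈ ((Maya.vac.clear a).fill b).occ := by
        rw [h']
        exact Maya.mem_vac.mpr ha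
      rcases Maya.mem_fill.mp h2 with h3 | h3
      · exact hab h3.symm
      · exact (Maya.mem_clear.mp h3).2 rfl
    by_cases hb : b ∈ (Maya.vac.clear a).occ
    · rw [psiStar_of_mem hb, mul_zero]
    · rw [psiStar_of_notMem hb, ket, if_neg (hne hb), mul_zero, mul_zero]

theorem corrMatrix_iterate (A : LowerTri) (n : ℕ) :
    corrMatrix ((secondQuant A)^[n] (ket Maya.vac)) =
      (fun Z => A * Z + Z * (-A))^[n] (proj (· < 0)) := by
  induction n with
  | zero => exact corrMatrix_vac
  | succ n ih =>
    rw [Function.iterate_succ_apply', Function.iterate_succ_apply', corrMatrix_secondQuant, ih]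
    -- stated for an abstract ring: `-A` is the pointwise negation of incidence functions, which
    -- `mul_neg` does not match syntactically
    have h : ∀ {R : Type} [Ring R] (a b : R), a * b - b * a = a * b + b * (-a) := by
      intro R _ a b
      rw [mul_neg, sub_eq_add_neg]
    exact h _ _

/-- The projector `g P g⁻¹` onto the span of `g e_{-1}, g e_{-2}, …` along the span of
`g e_0, g e_1, …`. -/
def dressedSea (g : LowerTriˣ) : LowerTri := g * proj (· < 0) * ((g⁻¹ : LowerTriˣ) : LowerTri)

theorem corrMatrix_cliffordExp {A : LowerTri} {g : LowerTriˣ} (hA : IsExp A (g : LowerTri)) :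
    corrMatrix (cliffordExp A (ket Maya.vac)) = dressedSea g := by
  refine lowerTri_ext fun b a => ?_
  obtain ⟨c, T, hc⟩ := exists_bra0_psi_psiStar_eq a b
  rw [entry_corrMatrix, hc, cliffordExp, ← tsum_mul_left, dressedSea,
    ← (hasSum_iterate_mul_add_mul hA (isExp_neg_inv hA) _ b a).tsum_eq]
  refine tsum_congr fun n => ?_
  rw [← corrMatrix_iterate, entry_corrMatrix, hc, mul_div_assoc]

theorem pairCorrOuter_eq {A : LowerTri} {g : LowerTriˣ} (hA : IsExp A (g : LowerTri)) (m n : ℤ) :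
    pairCorrOuter A m n = entry (dressedSea g) (-n - 1) m := by
  rw [← corrMatrix_cliffordExp hA, entry_corrMatrix]
  rfl

theorem entry_dressedSea_of_neg (g : LowerTriˣ) {i : ℤ} (hi : i < 0) (j : ℤ) :
    entry (dressedSea g) i j = if i = j then 1 else 0 := by
  rw [← entry_one, ← g.mul_inv, entry_mul, dressedSea, entry_mul]
  refine Finset.sum_congr rfl fun x hx => ?_
  rw [entry_mul_proj, if_pos ((Finset.mem_Icc.mp hx).2.trans_lt hi)]

theorem entry_dressedSea_of_nonneg (g : LowerTriˣ) {j : ℤ} (hj : 0 ≤ j) (i : ℤ) :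
    entry (dressedSea g) i j = 0 := by
  rw [dressedSea, entry_mul]
  refine Finset.sum_eq_zero fun x hx => ?_
  rw [entry_mul_proj, if_neg (not_lt.mpr (hj.trans (Finset.mem_Icc.mp hx).1)), zero_mul]

/-- Both expansions of the pair correlator differ by the formal delta function, because
`⟨0|ĝ|0⟩ = 1`. -/
theorem pairCorrInner_eq {A : LowerTri} {g : LowerTriˣ} (hA : IsExp A (g : LowerTri)) (m n : ℤ) :
    pairCorrInner A m n = entry (dressedSea g) (-n - 1) m - if -n - 1 = m then 1 else 0 := by
  have hvac : bra0 (cliffordExp A (ket Maya.vac)) = 1 := by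
    have h1 := bra0_psiStar_psi (-1) (-1) (cliffordExp A (ket Maya.vac))
    rw [bra0_psiStar (by norm_num), ← entry_corrMatrix, corrMatrix_cliffordExp hA,
      entry_dressedSea_of_neg g (by norm_num), if_pos rfl, if_pos rfl] at h1
    linear_combination -h1
  have h1 : pairCorrInner A m n =
      -bra0 (psiStar (-n - 1) (psi m (cliffordExp A (ket Maya.vac)))) := rfl
  rw [h1, bra0_psiStar_psi, hvac, ← entry_corrMatrix, corrMatrix_cliffordExp hA]
  ring

/-! ### Multiplication by `z - w` as a shift of the indices -/

/-- The matrix `Λ⁻¹ g Λ`, where `Λ` is the shift `e_i ↦ e_{i+1}`. It keeps the computation inside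
the ring of lower triangular matrices, to which `Λ⁻¹` does not belong. -/
def conjShift (g : LowerTri) : LowerTri := ofEntries fun i j => entry g (i + 1) (j + 1)

theorem entry_conjShift (g : LowerTri) (i j : ℤ) :
    entry (conjShift g) i j = entry g (i + 1) (j + 1) := by
  rcases le_or_gt j i with h | h
  · exact entry_ofEntries _ h
  · rw [entry_of_lt _ h, entry_of_lt _ (by omega)]

theorem conjShift_mul (a b : LowerTri) : conjShift (a * b) = conjShift a * conjShift b := by
  refine lowerTri_ext fun i j => ?_
  rw [entry_conjShift, entry_mul, entry_mul]
  refine Finset.sum_nbij' (· - 1) (· + 1) ?_ ?_ ?_ ?_ ?_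
  · intro x hx
    rw [Finset.mem_Icc] at hx ⊢
    omega
  · intro x hx
    rw [Finset.mem_Icc] at hx ⊢
    omega
  · intro x _
    ring
  · intro x _
    ring
  · intro x _
    rw [entry_conjShift, entry_conjShift, sub_add_cancel]

theorem conjShift_one : conjShift 1 = 1 := by
  refine lowerTri_ext fun i j => ?_
  simp only [entry_conjShift, entry_one, add_left_inj]

theorem conjShift_sub (a b : LowerTri) : conjShift (a - b) = conjShift a - conjShift b := by
  refine lowerTri_ext fun i j => ?_
  simp only [entry_conjShift, entry_sub]

theorem conjShift_proj (p : ℤ → Prop) [DecidablePred p] :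
    conjShift (proj p) = proj fun i => p (i + 1) := by
  refine lowerTri_ext fun i j => ?_
  simp only [entry_conjShift, entry_proj, add_left_inj]

theorem recMatrix_eq (g : LowerTriˣ) (k j : ℤ) :
    recMatrix g k j =
      entry (((g⁻¹ : LowerTriˣ) : LowerTri) * conjShift (g : LowerTri)) (-j) (-k - 1) := by
  rw [recMatrix, entry_mul]
  refine Finset.sum_congr rfl fun i _ => ?_
  rw [entry_conjShift, sub_add_cancel]

theorem one_sub_dressedSea (g : LowerTriˣ) :
    1 - dressedSea g = g * proj (0 ≤ ·) * ((g⁻¹ : LowerTriˣ) : LowerTri) := by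
  have h1 : (proj (0 ≤ ·) : LowerTri) = 1 - proj (· < 0) := by
    refine lowerTri_ext fun i j => ?_
    rw [entry_sub, entry_one, entry_proj, entry_proj]
    rcases eq_or_ne i j with rfl | h1
    · rcases lt_or_ge i 0 with h2 | h2
      · simp [h2, h2.not_ge]
      · simp [h2, h2.not_gt]
    · simp [h1]
  rw [h1, mul_sub, sub_mul, mul_one, g.mul_inv, dressedSea]

/-- The coefficients of `∑_{i,j ≥ 0} Q̃⁺_{j+1,-i} w^g_{-i}(z) w^{g*}_{-j}(w)`. -/
def kernelSum (g : LowerTriˣ) : BiSeries := fun m n =>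
  entry ((1 - dressedSea g) * conjShift (dressedSea g)) (-m - 1) (n - 1)

/-- The coefficients of `(z - w) K(w,z)`. -/
def kernelNumerator (g : LowerTriˣ) : BiSeries := fun m n =>
  entry (conjShift (dressedSea g) - dressedSea g) (-m - 1) (n - 1)

theorem hasFormalSum_kernelSum (g : LowerTriˣ) :
    HasFormalSum
      (fun p : ℕ × ℕ => recMatrix g ((p.2 : ℤ) + 1) (-(p.1 : ℤ)) •
        tensor (adapted g (-(p.1 : ℤ))) (adaptedDual g (-(p.2 : ℤ)))) (kernelSum g) := by
  intro m n
  set G : LowerTri := (g : LowerTri)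
  set H : LowerTri := ((g⁻¹ : LowerTriˣ) : LowerTri)
  set W : LowerTri := H * conjShift G
  set i := -m - 1
  set l := n - 1
  have hterm : ∀ p : ℕ × ℕ, (recMatrix g ((p.2 : ℤ) + 1) (-(p.1 : ℤ)) •
      tensor (adapted g (-(p.1 : ℤ))) (adaptedDual g (-(p.2 : ℤ)))) m n =
      entry G i p.1 * entry W p.1 (-p.2 - 2) * entry H (-p.2 - 1) n := by
    intro p
    have h1 : recMatrix g ((p.2 : ℤ) + 1) (-(p.1 : ℤ)) = entry W p.1 (-p.2 - 2) := by
      rw [recMatrix_eq]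
      congr 1 <;> ring
    simp only [Pi.smul_apply, tensor, adapted, adaptedDual, smul_eq_mul, h1, neg_neg]
    ring
  have hsupp : ∀ p : ℕ × ℕ, entry G i p.1 * entry W p.1 (-p.2 - 2) * entry H (-p.2 - 1) n ≠ 0 →
      p ∈ Finset.range (i + 1).toNat ×ˢ Finset.range (-n).toNat := by
    intro p hp
    rw [Finset.mem_product, Finset.mem_range, Finset.mem_range]
    by_contra hcon
    apply hp
    by_cases h1 : i < p.1
    · rw [entry_of_lt G h1]; ring
    · rw [entry_of_lt H (by omega)]; ring
  simp only [hterm]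
  refine ⟨(Finset.finite_toSet _).subset hsupp, ?_⟩
  rw [finsum_eq_sum_of_support_subset _ hsupp]
  have hmat : (1 - dressedSea g) * conjShift (dressedSea g) =
      (G * proj (0 ≤ ·)) * W * (proj (fun i => i + 1 < 0) * conjShift H) := by
    rw [one_sub_dressedSea, dressedSea, conjShift_mul, conjShift_mul, conjShift_proj]
    simp only [W, G, H, mul_assoc]
  rw [kernelSum, hmat, entry_mul_mul, ← Finset.sum_product']
  refine Finset.sum_bij_ne_zero (fun p _ _ => ((p.1 : ℤ), -(p.2 : ℤ) - 2)) ?_ ?_ ?_ ?_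
  · intro p hp _
    simp only [Finset.mem_product, Finset.mem_range, Finset.mem_Icc] at hp ⊢
    omega
  · intro p _ _ q _ _ h
    simp only [Prod.mk.injEq] at h
    ext <;> omega
  · rintro ⟨x, y⟩ _ hne
    simp only [entry_mul_proj, entry_proj_mul] at hne
    have hx : 0 ≤ x := by
      by_contra h
      simp [h] at hne
    have hy : y + 1 < 0 := by
      by_contra h
      simp [h] at hne
    rw [if_pos hx, if_pos hy, entry_conjShift] at hne
    obtain ⟨p, rfl⟩ := Int.eq_ofNat_of_zero_le hx
    obtain ⟨q, hq⟩ := Int.eq_ofNat_of_zero_le (show 0 ≤ -y - 2 by omega)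
    obtain rfl : y = -(q : ℤ) - 2 := by omega
    have e1 : -(q : ℤ) - 2 + 1 = -q - 1 := by ring
    have e2 : l + 1 = n := sub_add_cancel n 1
    rw [e1, e2] at hne
    exact ⟨(p, q), hsupp (p, q) hne, hne, rfl⟩
  · intro p _ _
    have e1 : -(p.2 : ℤ) - 2 + 1 = -p.2 - 1 := by ring
    have e2 : l + 1 = n := sub_add_cancel n 1
    rw [entry_mul_proj, entry_proj_mul, if_pos (by omega), if_pos (by omega), entry_conjShift,
      e1, e2]

/-- The correction term is `R (1 - Λ⁻¹RΛ)` for the projector `R`. The product `g⁻¹ Λ⁻¹ g Λ` is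
lower triangular, so its compression to the rows `i < 0` and the columns `j ≥ -1` has just one
nonzero entry. -/
theorem correction_eq (g : LowerTriˣ) (m n : ℤ) :
    entry (dressedSea g * (1 - conjShift (dressedSea g))) (-m - 1) (n - 1) =
      (recMatrix g 0 1 • tensor (adapted g 1) (adaptedDual g 1)) m n := by
  set G : LowerTri := (g : LowerTri)
  set H : LowerTri := ((g⁻¹ : LowerTriˣ) : LowerTri)
  set W : LowerTri := H * conjShift G
  have hmat : dressedSea g * (1 - conjShift (dressedSea g)) =
      (G * proj (· < 0)) * W * (proj (fun i => 0 ≤ i + 1) * conjShift H) := by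
    rw [← conjShift_one, ← conjShift_sub, one_sub_dressedSea, dressedSea, conjShift_mul,
      conjShift_mul, conjShift_proj]
    simp only [W, G, H, mul_assoc]
  have hzero : ∀ x y : ℤ, ¬(x = -1 ∧ y = -1) → entry (G * proj (· < 0)) (-m - 1) x * entry W x y *
      entry (proj (fun i => 0 ≤ i + 1) * conjShift H) y (n - 1) = 0 := by
    intro x y hxy
    rw [entry_mul_proj, entry_proj_mul]
    by_cases hx : x < 0
    · by_cases hy : 0 ≤ y + 1
      · rw [entry_of_lt W (by omega)]; ring
      · rw [if_neg hy]; ring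
    · rw [if_neg hx]; ring
  have hone : entry (G * proj (· < 0)) (-m - 1) (-1) * entry W (-1) (-1) *
      entry (proj (fun i => 0 ≤ i + 1) * conjShift H) (-1) (n - 1) =
      (recMatrix g 0 1 • tensor (adapted g 1) (adaptedDual g 1)) m n := by
    rw [entry_mul_proj, entry_proj_mul, if_pos (by norm_num), if_pos (by norm_num),
      entry_conjShift]
    simp only [Pi.smul_apply, tensor, adapted, adaptedDual, smul_eq_mul, recMatrix_eq,
      sub_add_cancel]
    norm_num
    ring
  rw [hmat, entry_mul_mul, ← hone]
  by_cases hmem : (-1 : ℤ) ∈ Finset.Icc (n - 1) (-m - 1)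
  · rw [Finset.sum_eq_single (-1), Finset.sum_eq_single (-1)]
    · exact fun y _ hy => hzero _ _ (by tauto)
    · exact fun h => absurd hmem h
    · exact fun x _ hx => Finset.sum_eq_zero fun y _ => hzero _ _ (by tauto)
    · exact fun h => absurd hmem h
  · rw [Finset.sum_eq_zero fun x hx => Finset.sum_eq_zero fun y hy => hzero _ _ ?_, eq_comm]
    · rw [Finset.mem_Icc, not_and_or, not_le, not_le] at hmem
      rcases hmem with h | h
      · rw [entry_of_lt (proj (fun i => 0 ≤ i + 1) * conjShift H) h]; ring
      · rw [entry_of_lt (G * proj (· < 0)) h]; ring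
    · rintro ⟨rfl, -⟩
      exact hmem hx

theorem kernelNumerator_eq (g : LowerTriˣ) :
    kernelNumerator g =
      kernelSum g - recMatrix g 0 1 • tensor (adapted g 1) (adaptedDual g 1) := by
  funext m n
  rw [Pi.sub_apply, Pi.sub_apply, ← correction_eq, kernelNumerator, kernelSum, ← entry_sub]
  congr 1
  rw [sub_mul, mul_sub, one_mul, mul_one]
  abel

theorem shift_sub_shift_swap_pairCorrOuter {A : LowerTri} {g : LowerTriˣ}
    (hA : IsExp A (g : LowerTri)) :
    shift 1 0 (swap (pairCorrOuter A)) - shift 0 1 (swap (pairCorrOuter A)) =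
      kernelNumerator g := by
  funext m n
  simp only [Pi.sub_apply, shift, swap, pairCorrOuter_eq hA, kernelNumerator, entry_sub,
    entry_conjShift, sub_zero, sub_add_cancel]
  congr 2
  ring

theorem shift_sub_shift_swap_pairCorrInner {A : LowerTri} {g : LowerTriˣ}
    (hA : IsExp A (g : LowerTri)) :
    shift 1 0 (swap (pairCorrInner A)) - shift 0 1 (swap (pairCorrInner A)) =
      kernelNumerator g := by
  rw [← shift_sub_shift_swap_pairCorrOuter hA]
  funext m n
  simp only [Pi.sub_apply, shift, swap, pairCorrOuter_eq hA, pairCorrInner_eq hA, sub_zero]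
  have h : (-(m - 1) - 1 = n) = (-m - 1 = n - 1) := by
    apply propext
    omega
  simp only [h]
  ring

/-! ### Division by `z - w` -/

theorem finsum_sub_succ {u : ℕ → ℂ} {K : ℕ} (hu : ∀ k, K ≤ k → u k = 0) :
    {k | u k - u (k + 1) ≠ 0}.Finite ∧ ∑ᶠ k, (u k - u (k + 1)) = u 0 := by
  have hsupp : ∀ k, u k - u (k + 1) ≠ 0 → k ∈ Finset.range K := by
    intro k hk
    rw [Finset.mem_range]
    by_contra h
    exact hk (by rw [hu k (by omega), hu (k + 1) (by omega), sub_zero])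
  refine ⟨(Finset.finite_toSet _).subset hsupp, ?_⟩
  rw [finsum_eq_sum_of_support_subset _ hsupp, Finset.sum_range_sub', hu K le_rfl, sub_zero]

/-- A series that vanishes far in the direction `z^k w^{-k}` is recovered from its product with
`z - w` by the expansion of `1 / (z - w)` in the region `|z| > |w|`. -/
theorem hasFormalSum_div_outer {F : BiSeries}
    (hF : ∀ m n : ℤ, ∃ K : ℕ, ∀ k : ℕ, K ≤ k → F (m + k) (n - k) = 0) :
    HasFormalSum (fun k : ℕ => shift (-(k : ℤ) - 1) (k : ℤ) (shift 1 0 F - shift 0 1 F)) F := by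
  intro m n
  obtain ⟨K, hK⟩ := hF m n
  have h := finsum_sub_succ (u := fun k : ℕ => F (m + k) (n - k)) hK
  have hterm : ∀ k : ℕ, shift (-(k : ℤ) - 1) (k : ℤ) (shift 1 0 F - shift 0 1 F) m n =
      F (m + k) (n - k) - F (m + (k + 1 : ℕ)) (n - (k + 1 : ℕ)) := by
    intro k
    simp only [shift, Pi.sub_apply]
    push_cast
    congr 2 <;> ring
  simp only [hterm]
  simpa using h

/-- A series that vanishes far in the direction `z^{-k} w^k` is recovered from its product with
`z - w` by the expansion of `1 / (z - w)` in the region `|z| < |w|`. -/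
theorem hasFormalSum_div_inner {F : BiSeries}
    (hF : ∀ m n : ℤ, ∃ K : ℕ, ∀ k : ℕ, K ≤ k → F (m - k) (n + k) = 0) :
    HasFormalSum (fun k : ℕ => -shift (k : ℤ) (-(k : ℤ) - 1) (shift 1 0 F - shift 0 1 F)) F := by
  intro m n
  obtain ⟨K, hK⟩ := hF m n
  have h := finsum_sub_succ (u := fun k : ℕ => F (m - k) (n + k)) hK
  have hterm : ∀ k : ℕ, (-shift (k : ℤ) (-(k : ℤ) - 1) (shift 1 0 F - shift 0 1 F)) m n =
      F (m - k) (n + k) - F (m - (k + 1 : ℕ)) (n + (k + 1 : ℕ)) := by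
    intro k
    simp only [shift, Pi.sub_apply, Pi.neg_apply, neg_sub]
    push_cast
    congr 2 <;> ring
  simp only [hterm]
  simpa using h

end FermionicCD
end
open FermionicCD in
theorem mainTheorem3 (g : LowerTriˣ) (A : LowerTri) (hA : IsExp A (g : LowerTri)) :
    ∃ S N : BiSeries,
      HasFormalSum
        (fun p : ℕ × ℕ => recMatrix g ((p.2 : ℤ) + 1) (-(p.1 : ℤ)) •
          tensor (adapted g (-(p.1 : ℤ))) (adaptedDual g (-(p.2 : ℤ)))) S ∧
      N = S - recMatrix g 0 1 • tensor (adapted g 1) (adaptedDual g 1) ∧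
      -- `(z - w) K(w,z) = N(z,w)` for both expansions of `K`
      shift 1 0 (swap (pairCorrInner A)) - shift 0 1 (swap (pairCorrInner A)) = N ∧
      shift 1 0 (swap (pairCorrOuter A)) - shift 0 1 (swap (pairCorrOuter A)) = N ∧
      -- `K(w,z) = N(z,w) / (z - w)`, expanded for `|z| > |w|` and for `|z| < |w|`
      HasFormalSum (fun k : ℕ => shift (-(k : ℤ) - 1) (k : ℤ) N) (swap (pairCorrInner A)) ∧
      HasFormalSum (fun k : ℕ => -shift (k : ℤ) (-(k : ℤ) - 1) N) (swap (pairCorrOuter A)) := by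
  refine ⟨kernelSum g, kernelNumerator g, hasFormalSum_kernelSum g, kernelNumerator_eq g,
    shift_sub_shift_swap_pairCorrInner hA, shift_sub_shift_swap_pairCorrOuter hA, ?_, ?_⟩
  · rw [← shift_sub_shift_swap_pairCorrInner hA]
    refine hasFormalSum_div_outer fun m n => ⟨(-m).toNat, fun k hk => ?_⟩
    rw [swap, pairCorrInner_eq hA, entry_dressedSea_of_neg g (by omega), sub_self]
  · rw [← shift_sub_shift_swap_pairCorrOuter hA]
    refine hasFormalSum_div_inner fun m n => ⟨(-n).toNat, fun k hk => ?_⟩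
    rw [swap, pairCorrOuter_eq hA, entry_dressedSea_of_nonneg g (by omega)]
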